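/- Let $L\in\mathbb N=\{1,2,\dots\}$, $\ell_0,\ell_1,\ell_2,\ldots\in\mathbb N$, for every $k\in\mathbb N_0$ let $\mathbf d_k=\sum_{n=1}^{k}\ell_n(\ell_{n-1}+1)$, and let $\mathfrak d=\mathbf d_L$. For a function $a\colon\mathbb R\to\mathbb R$, a parameter vector $\theta=(\theta_1,\dots,\theta_{\mathfrak d})\in\mathbb R^{\mathfrak d}$ and $x\in\mathbb R^{\ell_0}$ define $\mathcal N^{k,\theta}_a(x)\in\mathbb R^{\ell_k}$, $k\in\{1,\dots,L\}$, recursively by $$\mathcal N^{k+1,\theta}_{a,i}(x)=\theta_{\ell_{k+1}\ell_k+i+\mathbf d_k}+\sum_{j=1}^{\ell_k}\theta_{(i-1)\ell_k+j+\mathbf d_k}\,z_{k,j},\qquad z_{0,j}=x_j,\qquad z_{k,j}=a\big(\mathcal N^{k,\theta}_{a,j}(x)\big)\ (k\ge 1),$$ for $k\in\{0,\dots,L-1\}$, $i\in\{1,\dots,\ell_{k+1}\}$. Let $S\subseteq\mathbb R$ be finite, let $\mathbf g\colon S\to\mathbb R$, let $\mathfrak g_0\colon\mathbb R\to\mathbb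 R$ satisfy $\mathfrak g_0|_{\mathbb R\setminus S}\in C^1(\mathbb R\setminus S,\mathbb R)$, and define the generalized derivative $\mathscr d\colon\mathbb R\to\mathbb R$ by $\mathscr d(x)=(\mathfrak g_0)'(x)$ for $x\notin S$ and $\mathscr d(x)=\mathbf g(x)$ for $x\in S$. Let $\mathfrak g_n\in C^1(\mathbb R,\mathbb R)$, $n\in\mathbb N$, be such that for every $x\in\mathbb R$ there is $m\in\mathbb N$ with $\sum_{n=m}^\infty\big[|\mathfrak g_n(x)-\mathfrak g_0(x)|+|(\mathfrak g_n)'(x)-\mathscr d(x)|\big]=0$. Let $\mu$ be a finite Borel measure on $\mathbb R^{\ell_0}\times\mathbb R^{\ell_L}$ such that $\{x\in\mathbb R^{\ell_0}\colon \exists\,y\colon (x,y)\in\operatorname{supp}\mu\}$ is bounded, let $H\in C^1(\mathbb R^{\ell_L}\times\mathbb R^{\mathfrak d}\times\mathbb R^{\ell_L},\mathbb R)$, $(u,\theta,y)\mapsto H(u,\theta,y)$, assume for all $n\in\mathbb N_0$, $\theta\in\mathbb R^{\mathfrak d}$ that $\int|H(\mathcal N^{L,\theta}_{\mathfrak g_n}(x),\theta,y)|\,\mu(\mathrm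 dx,\mathrm dy)<\infty$, and let $$\mathcal L_n(\theta)=\int_{\mathbb R^{\ell_0}\times\mathbb R^{\ell_L}}H\big(\mathcal N^{L,\theta}_{\mathfrak g_n}(x),\theta,y\big)\,\mu(\mathrm dx,\mathrm dy).$$ Assume for all $r\in(0,\infty)$, $U\in[-r,r]^{\ell_L}$, $\Theta\in[-r,r]^{\mathfrak d}$ that the quotient $$\frac{\|\nabla_uH(u,\theta,y)\|+\|\nabla_\theta H(u,\theta,y)\|}{1+|H(U,\Theta,y)|}$$ is bounded over all $(x,y)\in\operatorname{supp}\mu$ with $x\in[-r,r]^{\ell_0}$, all $u\in[-r,r]^{\ell_L}$ and all $\theta\in[-r,r]^{\mathfrak d}$. Let $\mathcal G\colon\mathbb R^{\mathfrak d}\to\mathbb R^{\mathfrak d}$ satisfy $\mathcal G(\theta)=\lim_{n\to\infty}(\nabla\mathcal L_n)(\theta)$ for every $\theta\in\mathbb R^{\mathfrak d}$ for which $((\nabla\mathcal L_n)(\theta))_{n\in\mathbb N}$ converges. Assume for all $m\in\mathbb N$ that $\sup_{n\in\mathbb N}\sup_{x\in[-m,m]}\big[|\mathfrak g_n(x)|+|(\mathfrak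 g_n)'(x)|\big]<\infty$, and assume that $$\min_{z\in\{-1,1\}}\ \sum_{x\in S}\ \limsup_{h\searrow0}\,|\mathscr d(x+zh)-\mathscr d(x)|=0.$$ For $f\in C(\mathbb R^{\mathfrak d},\mathbb R)$ and $x\in\mathbb R^{\mathfrak d}$ let $$(\mathcal Df)(x)=\Big\{y\in\mathbb R^{\mathfrak d}\colon\liminf_{0\ne h\to0}\frac{f(x+h)-f(x)-\langle y,h\rangle}{\|h\|}\ge0\Big\},\qquad (\mathbb Df)(x)=\bigcap_{\varepsilon>0}\overline{\bigcup_{\|y-x\|<\varepsilon}(\mathcal Df)(y)}$$ denote the sets of Fréchet subgradients and of limiting Fréchet subgradients of $f$ at $x$. Then for every $\theta\in\mathbb R^{\mathfrak d}$ it holds that $\mathcal G(\theta)\in(\mathbb D\mathcal L_0)(\theta)$. -/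

import Mathlib

open Filter Topology MeasureTheory
open scoped ENNReal Gradient

noncomputable section

namespace DeepANN

/-- The function `𝒹_g f`: it is `f'` off `A` and `g` on `A`. -/
def genDeriv (A : Set ℝ) (g : A → ℝ) (f : ℝ → ℝ) (x : ℝ) : ℝ :=
  open Classical in if h : x ∈ A then g ⟨x, h⟩ else deriv f x

/-- The number `∑_{n=1}^k ℓ_n (ℓ_{n-1} + 1)` of parameters of the first `k` layers of the
architecture `ℓ`. -/
def numParams (ℓ : ℕ → ℕ) (k : ℕ) : ℕ :=
  ∑ n ∈ Finset.Icc 1 k, ℓ n * (ℓ (n - 1) + 1)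

/-- The parameter vectors of networks with `L` affine layers. -/
abbrev Param (ℓ : ℕ → ℕ) (L : ℕ) : Type := EuclideanSpace ℝ (Fin (numParams ℓ L))

/-- Coordinate number `m` (counted from `0`) of the parameter vector. It is extended by `0` past
the end of the vector, which is never reached in the layers `1, …, L`; see `weight_index_lt` and
`bias_index_lt`. -/
def coord {ℓ : ℕ → ℕ} {L : ℕ} (θ : Param ℓ L) (m : ℕ) : ℝ :=
  if h : m < numParams ℓ L then θ ⟨m, h⟩ else 0

/-- The weight from neuron `j` of layer `k` to neuron `i` of layer `k + 1`
(neurons counted from `0`). -/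
def weight {ℓ : ℕ → ℕ} {L : ℕ} (θ : Param ℓ L) (k : ℕ) (i : Fin (ℓ (k + 1))) (j : Fin (ℓ k)) : ℝ :=
  coord θ (i * ℓ k + j + numParams ℓ k)

/-- The bias of neuron `i` of layer `k + 1` (neurons counted from `0`). -/
def bias {ℓ : ℕ → ℕ} {L : ℕ} (θ : Param ℓ L) (k : ℕ) (i : Fin (ℓ (k + 1))) : ℝ :=
  coord θ (ℓ (k + 1) * ℓ k + i + numParams ℓ k)

theorem numParams_succ (ℓ : ℕ → ℕ) (k : ℕ) :
    numParams ℓ (k + 1) = numParams ℓ k + ℓ (k + 1) * (ℓ k + 1) := by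
  simp [numParams, Finset.sum_Icc_succ_top]

theorem numParams_mono (ℓ : ℕ → ℕ) : Monotone (numParams ℓ) :=
  monotone_nat_of_le_succ fun k => by rw [numParams_succ]; exact Nat.le_add_right _ _

theorem bias_index_lt {ℓ : ℕ → ℕ} {L k : ℕ} (hk : k < L) (i : Fin (ℓ (k + 1))) :
    ℓ (k + 1) * ℓ k + i + numParams ℓ k < numParams ℓ L := by
  have h := numParams_mono ℓ (Nat.succ_le_of_lt hk)
  rw [Nat.succ_eq_add_one, numParams_succ] at h
  have := i.isLt
  nlinarith

theorem weight_index_lt {ℓ : ℕ → ℕ} {L k : ℕ} (hk : k < L) (i : Fin (ℓ (k + 1)))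
    (j : Fin (ℓ k)) : i * ℓ k + j + numParams ℓ k < numParams ℓ L := by
  have h := numParams_mono ℓ (Nat.succ_le_of_lt hk)
  rw [Nat.succ_eq_add_one, numParams_succ] at h
  have hi := i.isLt
  have hj := j.isLt
  have : ((i : ℕ) + 1) * ℓ k ≤ ℓ (k + 1) * ℓ k := Nat.mul_le_mul_right _ hi
  nlinarith

/-- The affine map from layer `k` to layer `k + 1`. -/
def affineLayer {ℓ : ℕ → ℕ} {L : ℕ} (θ : Param ℓ L) (k : ℕ) (v : EuclideanSpace ℝ (Fin (ℓ k))) :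
    EuclideanSpace ℝ (Fin (ℓ (k + 1))) :=
  WithLp.toLp 2 fun i => bias θ k i + ∑ j, weight θ k i j * v j

/-- The realization `𝒩^{k,θ}(x)` of the first `k` layers with activation function `a`. The
activation is applied between consecutive affine maps, neither to the input nor after the last
affine map. -/
def realization {ℓ : ℕ → ℕ} {L : ℕ} (a : ℝ → ℝ) (θ : Param ℓ L)
    (x : EuclideanSpace ℝ (Fin (ℓ 0))) : (k : ℕ) → EuclideanSpace ℝ (Fin (ℓ k))
  | 0 => x
  | 1 => affineLayer θ 0 x
  | k + 2 => affineLayer θ (k + 1)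
      (WithLp.toLp 2 fun j => a (realization a θ x (k + 1) j))

/-- The risk `ℒ(θ) = ∫ H(𝒩^{L,θ}(x), θ, y) μ(dx, dy)` for the activation function `a`. -/
def risk {ℓ : ℕ → ℕ} {L : ℕ}
    (μ : Measure (EuclideanSpace ℝ (Fin (ℓ 0)) × EuclideanSpace ℝ (Fin (ℓ L))))
    (H : EuclideanSpace ℝ (Fin (ℓ L)) × Param ℓ L × EuclideanSpace ℝ (Fin (ℓ L)) → ℝ)
    (a : ℝ → ℝ) (θ : Param ℓ L) : ℝ :=
  ∫ p, H (realization a θ p.1 L, θ, p.2) ∂μ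

/-- `∑_{x ∈ S} limsup_{h ↘ 0} |f(x + z h) - f(x)|`, with values in `[0, ∞]`. -/
def oneSidedJump (S : Finset ℝ) (f : ℝ → ℝ) (z : ℝ) : ℝ≥0∞ :=
  ∑ x ∈ S, limsup (fun h : ℝ => ENNReal.ofReal |f (x + z * h) - f x|) (𝓝[>] 0)

/-- The set `(𝒟 f)(x)` of Fréchet subgradients. -/
def frechetSubdiff {n : ℕ} (f : EuclideanSpace ℝ (Fin n) → ℝ) (x : EuclideanSpace ℝ (Fin n)) :
    Set (EuclideanSpace ℝ (Fin n)) :=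
  {y | 0 ≤ liminf (fun h : EuclideanSpace ℝ (Fin n) =>
    (((f (x + h) - f x - inner ℝ y h) / ‖h‖ : ℝ) : EReal)) (𝓝[≠] 0)}

/-- The limiting Fréchet subdifferential `(𝔻 f)(x)`. -/
def limitingSubdiff {n : ℕ} (f : EuclideanSpace ℝ (Fin n) → ℝ) (x : EuclideanSpace ℝ (Fin n)) :
    Set (EuclideanSpace ℝ (Fin n)) :=
  ⋂ ε ∈ Set.Ioi (0 : ℝ), closure (⋃ y ∈ Metric.ball x ε, frechetSubdiff f y)

end DeepANN

end

/-! Backpropagation with the generalized derivative `b 0` in place of the derivative of `a 0` gives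
a formal gradient of the loss, defined for every parameter and every data point. At a fixed
parameter and data point only finitely many preactivations occur, so the formal gradients for `a n`
eventually equal the one for `a 0`. Dominated convergence (`tendsto_integral_lossDeriv`) therefore
identifies `G θ` with the integral of the formal gradient for `a 0`. The majorant `C * (1 + |H (0,
0, y)|)` comes from `exists_lossDeriv_bound`.

It remains to approximate this integral by true gradients of the risk. Let `z` be the side from
which the generalized derivative is continuous at all kinks. Changing only the biases,
`exists_direction` finds a segment `θ + t • v` along which every preactivation moves strictly
towards side `z`. This has two effects.

(1) For a fixed neuron and kink, the sets of inputs that hit the kink at different times `t` are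
disjoint up to a null set, so only countably many of them have positive mass. Hence for arbitrarily
small `t` almost no input meets a kink (`frequently_ae_notMem`). There the risk is differentiable
with the formal gradient (`hasFDerivAt_risk`), which is then a Fréchet subgradient.

(2) As `t` decreases to `0`, preactivations that end at a kink approach it from side `z`, so the
integrated formal gradients converge to the one at `θ`.

Thus `G θ` is a limit of Fréchet subgradients at points tending to `θ`. -/

noncomputable section

namespace DeepANN

variable {ℓ : ℕ → ℕ} {L : ℕ}

/-! ### Parameter functionals and formal backpropagation. -/

/-- The coordinate functional `coord · m`. -/
def coordL (ℓ : ℕ → ℕ) (L m : ℕ) : Param ℓ L →L[ℝ] ℝ :=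
  if h : m < numParams ℓ L then EuclideanSpace.proj ⟨m, h⟩ else 0

theorem coordL_apply (θ : Param ℓ L) (m : ℕ) : coordL ℓ L m θ = coord θ m := by
  unfold coordL coord
  split_ifs <;> simp

theorem abs_coord_le (θ : Param ℓ L) (m : ℕ) : |coord θ m| ≤ ‖θ‖ := by
  unfold coord
  split_ifs
  · exact PiLp.norm_apply_le θ _
  · simp

theorem norm_coordL_le (m : ℕ) : ‖coordL ℓ L m‖ ≤ 1 :=
  ContinuousLinearMap.opNorm_le_bound _ zero_le_one fun θ => by
    rw [coordL_apply, one_mul]; exact abs_coord_le θ m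

/-- The functional `weight · k i j`. -/
def weightL (L k : ℕ) (i : Fin (ℓ (k + 1))) (j : Fin (ℓ k)) : Param ℓ L →L[ℝ] ℝ :=
  coordL ℓ L (i * ℓ k + j + numParams ℓ k)

/-- The functional `bias · k i`. -/
def biasL (L k : ℕ) (i : Fin (ℓ (k + 1))) : Param ℓ L →L[ℝ] ℝ :=
  coordL ℓ L (ℓ (k + 1) * ℓ k + i + numParams ℓ k)

theorem weightL_apply (θ : Param ℓ L) (k : ℕ) (i : Fin (ℓ (k + 1))) (j : Fin (ℓ k)) :
    weightL L k i j θ = weight θ k i j := coordL_apply _ _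

theorem biasL_apply (θ : Param ℓ L) (k : ℕ) (i : Fin (ℓ (k + 1))) :
    biasL L k i θ = bias θ k i := coordL_apply _ _

theorem continuous_weight (k : ℕ) (i : Fin (ℓ (k + 1))) (j : Fin (ℓ k)) :
    Continuous fun θ : Param ℓ L => weight θ k i j := by
  simp_rw [← weightL_apply]; exact (weightL L k i j).continuous

theorem continuous_bias (k : ℕ) (i : Fin (ℓ (k + 1))) :
    Continuous fun θ : Param ℓ L => bias θ k i := by
  simp_rw [← biasL_apply]; exact (biasL L k i).continuous

/-- The values passed from layer `k` to the affine map of layer `k + 1`: the input for `k = 0`, and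
the activated preactivations otherwise. -/
def layerOut (a : ℝ → ℝ) (θ : Param ℓ L) (x : EuclideanSpace ℝ (Fin (ℓ 0))) :
    (k : ℕ) → EuclideanSpace ℝ (Fin (ℓ k))
  | 0 => x
  | k + 1 => WithLp.toLp 2 fun j => a (realization a θ x (k + 1) j)

theorem realization_succ (a : ℝ → ℝ) (θ : Param ℓ L) (x : EuclideanSpace ℝ (Fin (ℓ 0))) (k : ℕ)
    (i : Fin (ℓ (k + 1))) :
    realization a θ x (k + 1) i = bias θ k i + ∑ j, weight θ k i j * layerOut a θ x k j := by
  cases k <;> rfl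

theorem layerOut_succ (a : ℝ → ℝ) (θ : Param ℓ L) (x : EuclideanSpace ℝ (Fin (ℓ 0))) (k : ℕ)
    (j : Fin (ℓ (k + 1))) :
    layerOut a θ x (k + 1) j = a (realization a θ x (k + 1) j) := rfl

/-- The formal derivative with respect to the parameters of `layerOut`, where `b` takes the place of
the derivative of `a`. -/
def outDeriv (a b : ℝ → ℝ) (θ : Param ℓ L) (x : EuclideanSpace ℝ (Fin (ℓ 0))) :
    (k : ℕ) → Fin (ℓ k) → Param ℓ L →L[ℝ] ℝ
  | 0, _ => 0
  | k + 1, i => b (realization a θ x (k + 1) i) • (biasL L k i +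
      ∑ j, (weight θ k i j • outDeriv a b θ x k j + layerOut a θ x k j • weightL L k i j))

/-- The formal derivative with respect to the parameters of the preactivation of neuron `i` of
layer `k + 1`, where `b` takes the place of the derivative of `a`. -/
def preDeriv (a b : ℝ → ℝ) (θ : Param ℓ L) (x : EuclideanSpace ℝ (Fin (ℓ 0)))
    (k : ℕ) (i : Fin (ℓ (k + 1))) : Param ℓ L →L[ℝ] ℝ :=
  biasL L k i +
    ∑ j, (weight θ k i j • outDeriv a b θ x k j + layerOut a θ x k j • weightL L k i j)

theorem outDeriv_succ (a b : ℝ → ℝ) (θ : Param ℓ L) (x : EuclideanSpace ℝ (Fin (ℓ 0))) (k : ℕ)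
    (i : Fin (ℓ (k + 1))) :
    outDeriv a b θ x (k + 1) i = b (realization a θ x (k + 1) i) • preDeriv a b θ x k i := rfl

theorem hasFDerivAt_realization_of_layerOut {a b : ℝ → ℝ} {θ : Param ℓ L}
    {x : EuclideanSpace ℝ (Fin (ℓ 0))} {k : ℕ}
    (h : ∀ j, HasFDerivAt (fun θ' : Param ℓ L => layerOut a θ' x k j) (outDeriv a b θ x k j) θ)
    (i : Fin (ℓ (k + 1))) :
    HasFDerivAt (fun θ' : Param ℓ L => realization a θ' x (k + 1) i) (preDeriv a b θ x k i) θ := by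
  simp_rw [realization_succ, ← biasL_apply, ← weightL_apply]
  refine (biasL L k i).hasFDerivAt.add (HasFDerivAt.fun_sum fun j _ => ?_)
  rw [← weightL_apply]
  exact (weightL L k i j).hasFDerivAt.mul (h j)

theorem hasFDerivAt_layerOut {a b : ℝ → ℝ} {θ : Param ℓ L} {x : EuclideanSpace ℝ (Fin (ℓ 0))}
    {k : ℕ} (h : ∀ m < k, ∀ i, HasDerivAt a (b (realization a θ x (m + 1) i))
      (realization a θ x (m + 1) i)) (j : Fin (ℓ k)) :
    HasFDerivAt (fun θ' : Param ℓ L => layerOut a θ' x k j) (outDeriv a b θ x k j) θ := by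
  induction k with
  | zero => exact hasFDerivAt_const (𝕜 := ℝ) (x j) θ
  | succ k ih =>
    exact (h k k.lt_succ_self j).comp_hasFDerivAt θ
      (hasFDerivAt_realization_of_layerOut (ih fun m hm => h m (hm.trans k.lt_succ_self)) j)

theorem hasFDerivAt_realization {a b : ℝ → ℝ} {θ : Param ℓ L} {x : EuclideanSpace ℝ (Fin (ℓ 0))}
    {k : ℕ} (h : ∀ m < k, ∀ i, HasDerivAt a (b (realization a θ x (m + 1) i))
      (realization a θ x (m + 1) i)) (i : Fin (ℓ (k + 1))) :
    HasFDerivAt (fun θ' : Param ℓ L => realization a θ' x (k + 1) i) (preDeriv a b θ x k i) θ :=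
  hasFDerivAt_realization_of_layerOut (hasFDerivAt_layerOut h) i

/-! ### Convergence, eventual equality and bounds for the layers. -/

/-- Convergence of all layers along a filter on activations, formal derivatives, parameters and
inputs. -/
theorem tendsto_layers {ι : Type*} {l : Filter ι} {a b : ι → ℝ → ℝ} {θ : ι → Param ℓ L}
    {x : ι → EuclideanSpace ℝ (Fin (ℓ 0))} {a₀ b₀ : ℝ → ℝ} {θ₀ : Param ℓ L}
    {x₀ : EuclideanSpace ℝ (Fin (ℓ 0))} (hθ : Tendsto θ l (𝓝 θ₀)) (hx : Tendsto x l (𝓝 x₀))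
    {k : ℕ}
    (hab : ∀ m < k, ∀ i, Tendsto (fun t => realization (a t) (θ t) (x t) (m + 1) i) l
        (𝓝 (realization a₀ θ₀ x₀ (m + 1) i)) →
      Tendsto (fun t => a t (realization (a t) (θ t) (x t) (m + 1) i)) l
        (𝓝 (a₀ (realization a₀ θ₀ x₀ (m + 1) i))) ∧
      Tendsto (fun t => b t (realization (a t) (θ t) (x t) (m + 1) i)) l
        (𝓝 (b₀ (realization a₀ θ₀ x₀ (m + 1) i)))) (i : Fin (ℓ (k + 1))) :
    Tendsto (fun t => realization (a t) (θ t) (x t) (k + 1) i) l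
        (𝓝 (realization a₀ θ₀ x₀ (k + 1) i)) ∧
      Tendsto (fun t => preDeriv (a t) (b t) (θ t) (x t) k i) l (𝓝 (preDeriv a₀ b₀ θ₀ x₀ k i)) := by
  -- The induction invokes `hab` on a layer only once convergence of its preactivations is known, so
  -- `b₀` need not be continuous: convergence along this particular family is enough.
  have step : ∀ k, (∀ j, Tendsto (fun t => layerOut (a t) (θ t) (x t) k j) l
        (𝓝 (layerOut a₀ θ₀ x₀ k j)) ∧
      Tendsto (fun t => outDeriv (a t) (b t) (θ t) (x t) k j) l (𝓝 (outDeriv a₀ b₀ θ₀ x₀ k j))) →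
      ∀ i, Tendsto (fun t => realization (a t) (θ t) (x t) (k + 1) i) l
        (𝓝 (realization a₀ θ₀ x₀ (k + 1) i)) ∧
      Tendsto (fun t => preDeriv (a t) (b t) (θ t) (x t) k i) l
        (𝓝 (preDeriv a₀ b₀ θ₀ x₀ k i)) := by
    intro k h i
    have hw : ∀ j, Tendsto (fun t => weight (θ t) k i j) l (𝓝 (weight θ₀ k i j)) := fun j =>
      ((continuous_weight k i j).tendsto θ₀).comp hθ
    constructor
    · simp_rw [realization_succ]
      exact (((continuous_bias k i).tendsto θ₀).comp hθ).add
        (tendsto_finsetSum _ fun j _ => (hw j).mul (h j).1)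
    · exact tendsto_const_nhds.add (tendsto_finsetSum _ fun j _ =>
        ((hw j).smul (h j).2).add ((h j).1.smul tendsto_const_nhds))
  refine step k ?_ i
  clear i
  induction k with
  | zero =>
    refine fun j => ⟨?_, tendsto_const_nhds⟩
    exact ((PiLp.continuous_apply 2 (fun _ : Fin (ℓ 0) => ℝ) j).tendsto x₀).comp hx
  | succ k ih =>
    intro j
    have h := step k (ih fun m hm => hab m (hm.trans k.lt_succ_self)) j
    have h' := hab k k.lt_succ_self j h.1
    exact ⟨h'.1, h'.2.smul h.2⟩

theorem eventually_layers_eq {a b : ℕ → ℝ → ℝ}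
    (h : ∀ x, ∀ᶠ n in atTop, a n x = a 0 x ∧ b n x = b 0 x) (θ : Param ℓ L)
    (x : EuclideanSpace ℝ (Fin (ℓ 0))) (k : ℕ) :
    ∀ᶠ n in atTop, ∀ i, realization (a n) θ x (k + 1) i = realization (a 0) θ x (k + 1) i ∧
      preDeriv (a n) (b n) θ x k i = preDeriv (a 0) (b 0) θ x k i := by
  have step : ∀ k n, (∀ j, layerOut (a n) θ x k j = layerOut (a 0) θ x k j ∧
      outDeriv (a n) (b n) θ x k j = outDeriv (a 0) (b 0) θ x k j) →
      ∀ i, realization (a n) θ x (k + 1) i = realization (a 0) θ x (k + 1) i ∧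
        preDeriv (a n) (b n) θ x k i = preDeriv (a 0) (b 0) θ x k i := by
    intro k n h i
    simp [realization_succ, preDeriv, h]
  have main : ∀ᶠ n in atTop, ∀ j, layerOut (a n) θ x k j = layerOut (a 0) θ x k j ∧
      outDeriv (a n) (b n) θ x k j = outDeriv (a 0) (b 0) θ x k j := by
    induction k with
    | zero => exact Eventually.of_forall fun n j => ⟨rfl, rfl⟩
    | succ k ih =>
      filter_upwards [ih, eventually_all.2 fun i => h (realization (a 0) θ x (k + 1) i)]
        with n hn hn' j
      have := step k n hn j
      rw [layerOut_succ, layerOut_succ, outDeriv_succ, outDeriv_succ, this.1, this.2, (hn' j).1,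
        (hn' j).2]
      exact ⟨rfl, rfl⟩
  exact main.mono fun n hn => step k n hn

/-- The bound on the preactivations of one layer serves as the radius in `h` for the next one, so
the constant is uniform in `n`. -/
theorem exists_layers_bound {ι : Type*} {a b : ι → ℝ → ℝ}
    (h : ∀ R : ℝ, ∃ C, ∀ n x, |x| ≤ R → |a n x| ≤ C ∧ |b n x| ≤ C) (R : ℝ) (k : ℕ) :
    ∃ C, ∀ n (θ : Param ℓ L) (x : EuclideanSpace ℝ (Fin (ℓ 0))), ‖θ‖ ≤ R → ‖x‖ ≤ R →
      ∀ i, |realization (a n) θ x (k + 1) i| ≤ C ∧ ‖preDeriv (a n) (b n) θ x k i‖ ≤ C := by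
  have step : ∀ k, (∃ C, ∀ n (θ : Param ℓ L) (x : EuclideanSpace ℝ (Fin (ℓ 0))), ‖θ‖ ≤ R →
      ‖x‖ ≤ R → ∀ i, |layerOut (a n) θ x k i| ≤ C ∧ ‖outDeriv (a n) (b n) θ x k i‖ ≤ C) →
      ∃ C, ∀ n (θ : Param ℓ L) (x : EuclideanSpace ℝ (Fin (ℓ 0))), ‖θ‖ ≤ R → ‖x‖ ≤ R →
      ∀ i, |realization (a n) θ x (k + 1) i| ≤ C ∧ ‖preDeriv (a n) (b n) θ x k i‖ ≤ C := by
    rintro k ⟨C, hC⟩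
    refine ⟨max (R + ∑ j : Fin (ℓ k), R * C) (1 + ∑ j : Fin (ℓ k), (R * C + C * 1)),
      fun n θ x hθ hx i => ⟨le_max_of_le_left ?_, le_max_of_le_right ?_⟩⟩
    · rw [realization_succ]
      refine (abs_add_le _ _).trans (add_le_add ((abs_coord_le _ _).trans hθ) ?_)
      refine (Finset.abs_sum_le_sum_abs _ _).trans (Finset.sum_le_sum fun j _ => ?_)
      rw [abs_mul]
      exact mul_le_mul ((abs_coord_le _ _).trans hθ) (hC n θ x hθ hx j).1 (abs_nonneg _)
        ((norm_nonneg _).trans hθ)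
    · refine (norm_add_le _ _).trans (add_le_add (norm_coordL_le _) ?_)
      refine (norm_sum_le _ _).trans (Finset.sum_le_sum fun j _ => ?_)
      refine (norm_add_le _ _).trans (add_le_add ?_ ?_)
      · rw [norm_smul]
        exact mul_le_mul ((abs_coord_le _ _).trans hθ) (hC n θ x hθ hx j).2 (norm_nonneg _)
          ((norm_nonneg _).trans hθ)
      · rw [norm_smul]
        exact mul_le_mul (hC n θ x hθ hx j).1 (norm_coordL_le _) (norm_nonneg _)
          ((abs_nonneg _).trans (hC n θ x hθ hx j).1)
  refine step k ?_
  induction k with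
  | zero =>
    refine ⟨R, fun n θ x hθ hx i => ⟨(PiLp.norm_apply_le x i).trans hx, ?_⟩⟩
    simpa [outDeriv] using (norm_nonneg _).trans hx
  | succ k ih =>
    obtain ⟨K, hK⟩ := step k ih
    obtain ⟨C, hC⟩ := h K
    refine ⟨max C (C * K), fun n θ x hθ hx i => ?_⟩
    have h1 := hK n θ x hθ hx i
    have h2 := hC n _ h1.1
    refine ⟨le_max_of_le_left h2.1, le_max_of_le_right ?_⟩
    rw [outDeriv_succ, norm_smul]
    exact mul_le_mul h2.2 h1.2 (norm_nonneg _) ((abs_nonneg _).trans h2.2)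

/-! ### The loss and its formal derivative. -/

/-- The formal derivative with respect to the parameters of the preactivation of layer `k + 1`. -/
def realizationDeriv (a b : ℝ → ℝ) (θ : Param ℓ L) (x : EuclideanSpace ℝ (Fin (ℓ 0))) (k : ℕ) :
    Param ℓ L →L[ℝ] EuclideanSpace ℝ (Fin (ℓ (k + 1))) :=
  ∑ i, (preDeriv a b θ x k i).smulRight (EuclideanSpace.single i 1)

/-- The formal derivative with respect to the parameters `θ` of `H (𝒩(x), θ, y)`. -/
def lossDeriv {k : ℕ}
    (H : EuclideanSpace ℝ (Fin (ℓ (k + 1))) × Param ℓ (k + 1) ×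
      EuclideanSpace ℝ (Fin (ℓ (k + 1))) → ℝ) (a b : ℝ → ℝ) (θ : Param ℓ (k + 1))
    (p : EuclideanSpace ℝ (Fin (ℓ 0)) × EuclideanSpace ℝ (Fin (ℓ (k + 1)))) :
    Param ℓ (k + 1) →L[ℝ] ℝ :=
  (fderiv ℝ H (realization a θ p.1 (k + 1), θ, p.2)).comp
    ((realizationDeriv a b θ p.1 k).prod ((ContinuousLinearMap.id ℝ _).prod 0))

theorem sum_smul_single {n : ℕ} (v : EuclideanSpace ℝ (Fin n)) :
    ∑ i, v i • EuclideanSpace.single i (1 : ℝ) = v := by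
  ext j
  simp [Finset.sum_apply, Pi.single_apply]

theorem tendsto_euclidean {ι : Type*} {l : Filter ι} {n : ℕ} {f : ι → EuclideanSpace ℝ (Fin n)}
    {v : EuclideanSpace ℝ (Fin n)} (h : ∀ i, Tendsto (fun t => f t i) l (𝓝 (v i))) :
    Tendsto f l (𝓝 v) := by
  have := tendsto_finsetSum Finset.univ fun i _ =>
    (h i).smul (tendsto_const_nhds (x := EuclideanSpace.single i (1 : ℝ)))
  simpa only [sum_smul_single] using this

theorem norm_realizationDeriv_le {a b : ℝ → ℝ} {θ : Param ℓ L}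
    {x : EuclideanSpace ℝ (Fin (ℓ 0))} {k : ℕ} {C : ℝ} (h : ∀ i, ‖preDeriv a b θ x k i‖ ≤ C) :
    ‖realizationDeriv a b θ x k‖ ≤ ℓ (k + 1) * C := by
  refine (norm_sum_le_of_le (f := fun i => (preDeriv a b θ x k i).smulRight
    (EuclideanSpace.single i (1 : ℝ))) (n := fun _ => C) Finset.univ fun i _ => ?_).trans ?_
  · rw [ContinuousLinearMap.norm_smulRight_apply]
    simpa using h i
  · simp

theorem hasFDerivAt_loss {k : ℕ}
    {H : EuclideanSpace ℝ (Fin (ℓ (k + 1))) × Param ℓ (k + 1) ×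
      EuclideanSpace ℝ (Fin (ℓ (k + 1))) → ℝ} (hH : ContDiff ℝ 1 H) {a b : ℝ → ℝ}
    {θ : Param ℓ (k + 1)} {p : EuclideanSpace ℝ (Fin (ℓ 0)) × EuclideanSpace ℝ (Fin (ℓ (k + 1)))}
    (h : ∀ m < k, ∀ i, HasDerivAt a (b (realization a θ p.1 (m + 1) i))
      (realization a θ p.1 (m + 1) i)) :
    HasFDerivAt (fun θ' => H (realization a θ' p.1 (k + 1), θ', p.2)) (lossDeriv H a b θ p) θ := by
  have h1 : HasFDerivAt (fun θ' : Param ℓ (k + 1) => realization a θ' p.1 (k + 1))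
      (realizationDeriv a b θ p.1 k) θ := by
    have : HasFDerivAt (fun θ' : Param ℓ (k + 1) => ∑ i, realization a θ' p.1 (k + 1) i •
        EuclideanSpace.single i (1 : ℝ)) (realizationDeriv a b θ p.1 k) θ :=
      HasFDerivAt.fun_sum fun i _ => (hasFDerivAt_realization h i).smul_const _
    simpa only [sum_smul_single] using this
  exact ((hH.differentiable one_ne_zero).differentiableAt.hasFDerivAt).comp θ
    (h1.prodMk ((hasFDerivAt_id θ).prodMk (hasFDerivAt_const p.2 θ)))

theorem continuous_comp_prod {E F G : Type*} [NormedAddCommGroup E] [NormedSpace ℝ E]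
    [NormedAddCommGroup F] [NormedSpace ℝ F] [NormedAddCommGroup G] [NormedSpace ℝ G]
    (J : E →L[ℝ] G) :
    Continuous fun q : (F × G →L[ℝ] ℝ) × (E →L[ℝ] F) => q.1.comp (q.2.prod J) := by
  have h : ∀ D : E →L[ℝ] F, D.prod J =
      (ContinuousLinearMap.inl ℝ F G).comp D + (ContinuousLinearMap.inr ℝ F G).comp J := by
    intro D; ext w <;> simp
  simp_rw [h]
  exact continuous_fst.clm_comp ((continuous_const.clm_comp continuous_snd).add continuous_const)

theorem tendsto_lossDeriv {ι : Type*} {l : Filter ι} {k : ℕ}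
    {H : EuclideanSpace ℝ (Fin (ℓ (k + 1))) × Param ℓ (k + 1) ×
      EuclideanSpace ℝ (Fin (ℓ (k + 1))) → ℝ} (hH : ContDiff ℝ 1 H) {a b : ℝ → ℝ}
    {θ : ι → Param ℓ (k + 1)} {θ₀ : Param ℓ (k + 1)}
    {p : ι → EuclideanSpace ℝ (Fin (ℓ 0)) × EuclideanSpace ℝ (Fin (ℓ (k + 1)))}
    {p₀ : EuclideanSpace ℝ (Fin (ℓ 0)) × EuclideanSpace ℝ (Fin (ℓ (k + 1)))}
    (hθ : Tendsto θ l (𝓝 θ₀)) (hp : Tendsto p l (𝓝 p₀)) (ha : Continuous a)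
    (hb : ∀ m < k, ∀ i, Tendsto (fun t => realization a (θ t) (p t).1 (m + 1) i) l
        (𝓝 (realization a θ₀ p₀.1 (m + 1) i)) →
      Tendsto (fun t => b (realization a (θ t) (p t).1 (m + 1) i)) l
        (𝓝 (b (realization a θ₀ p₀.1 (m + 1) i)))) :
    Tendsto (fun t => lossDeriv H a b (θ t) (p t)) l (𝓝 (lossDeriv H a b θ₀ p₀)) := by
  have key := tendsto_layers (a := fun _ => a) (b := fun _ => b) hθ (hp.fst_nhds)
    fun m hm i h => ⟨(ha.tendsto _).comp h, hb m hm i h⟩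
  have h1 : Tendsto (fun t => realization a (θ t) (p t).1 (k + 1)) l
      (𝓝 (realization a θ₀ p₀.1 (k + 1))) := tendsto_euclidean fun i => (key i).1
  have h2 : Tendsto (fun t => realizationDeriv a b (θ t) (p t).1 k) l
      (𝓝 (realizationDeriv a b θ₀ p₀.1 k)) := by
    refine tendsto_finsetSum _ fun i _ => ?_
    exact (((ContinuousLinearMap.smulRightL ℝ (Param ℓ (k + 1)) _).flip
      (EuclideanSpace.single i (1 : ℝ))).continuous.tendsto _).comp (key i).2
  have h3 := ((hH.continuous_fderiv one_ne_zero).tendsto _).comp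
    (h1.prodMk_nhds (hθ.prodMk_nhds hp.snd_nhds))
  exact ((continuous_comp_prod _).tendsto _).comp (h3.prodMk_nhds h2)

theorem eventually_loss_eq {k : ℕ}
    (H : EuclideanSpace ℝ (Fin (ℓ (k + 1))) × Param ℓ (k + 1) ×
      EuclideanSpace ℝ (Fin (ℓ (k + 1))) → ℝ) {a b : ℕ → ℝ → ℝ}
    (h : ∀ x, ∀ᶠ n in atTop, a n x = a 0 x ∧ b n x = b 0 x) (θ : Param ℓ (k + 1))
    (p : EuclideanSpace ℝ (Fin (ℓ 0)) × EuclideanSpace ℝ (Fin (ℓ (k + 1)))) :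
    ∀ᶠ n in atTop, realization (a n) θ p.1 (k + 1) = realization (a 0) θ p.1 (k + 1) ∧
      lossDeriv H (a n) (b n) θ p = lossDeriv H (a 0) (b 0) θ p := by
  filter_upwards [eventually_layers_eq h θ p.1 k] with n hn
  have h1 : realization (a n) θ p.1 (k + 1) = realization (a 0) θ p.1 (k + 1) :=
    PiLp.ext fun i => (hn i).1
  refine ⟨h1, ?_⟩
  unfold lossDeriv realizationDeriv
  rw [h1]
  simp_rw [(hn _).2]

/-- Splits the total derivative into the two partial gradients that the growth condition controls.
-/
theorem norm_fderiv_comp_le {k : ℕ}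
    {H : EuclideanSpace ℝ (Fin (ℓ (k + 1))) × Param ℓ (k + 1) ×
      EuclideanSpace ℝ (Fin (ℓ (k + 1))) → ℝ} (hH : ContDiff ℝ 1 H)
    (u y : EuclideanSpace ℝ (Fin (ℓ (k + 1)))) (θ : Param ℓ (k + 1))
    (D : Param ℓ (k + 1) →L[ℝ] EuclideanSpace ℝ (Fin (ℓ (k + 1)))) :
    ‖(fderiv ℝ H (u, θ, y)).comp (D.prod ((ContinuousLinearMap.id ℝ _).prod 0))‖ ≤
      (1 + ‖D‖) * (‖∇ (fun u' => H (u', θ, y)) u‖ + ‖∇ (fun θ' => H (u, θ', y)) θ‖) := by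
  have hd := ((hH.differentiable one_ne_zero).differentiableAt (x := (u, θ, y))).hasFDerivAt
  have e1 : ‖∇ (fun u' => H (u', θ, y)) u‖ = ‖fderiv ℝ (fun u' => H (u', θ, y)) u‖ := by
    rw [← toDual_gradient, LinearIsometryEquiv.norm_map]
  have e2 : ‖∇ (fun θ' => H (u, θ', y)) θ‖ = ‖fderiv ℝ (fun θ' => H (u, θ', y)) θ‖ := by
    rw [← toDual_gradient, LinearIsometryEquiv.norm_map]
  have e3 : (fderiv ℝ H (u, θ, y)).comp (D.prod ((ContinuousLinearMap.id ℝ _).prod 0)) =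
      (fderiv ℝ (fun u' => H (u', θ, y)) u).comp D + fderiv ℝ (fun θ' => H (u, θ', y)) θ := by
    have h1 : HasFDerivAt (fun u' => H (u', θ, y)) _ u := HasFDerivAt.comp (f := fun u' => (u', θ, y))
      u hd ((hasFDerivAt_id u).prodMk (hasFDerivAt_const (θ, y) u))
    have h2 : HasFDerivAt (fun θ' => H (u, θ', y)) _ θ := HasFDerivAt.comp (f := fun θ' => (u, θ', y))
      θ hd ((hasFDerivAt_const u θ).prodMk ((hasFDerivAt_id θ).prodMk (hasFDerivAt_const y θ)))
    rw [h1.fderiv, h2.fderiv]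
    ext w
    simp [← map_add]
  rw [e1, e2, e3]
  have h3 := norm_add_le ((fderiv ℝ (fun u' => H (u', θ, y)) u).comp D)
    (fderiv ℝ (fun θ' => H (u, θ', y)) θ)
  have h4 := (fderiv ℝ (fun u' => H (u', θ, y)) u).opNorm_comp_le D
  nlinarith [norm_nonneg (fderiv ℝ (fun u' => H (u', θ, y)) u), norm_nonneg D,
    norm_nonneg (fderiv ℝ (fun θ' => H (u, θ', y)) θ)]

theorem exists_lossDeriv_bound {ι : Type*} {k : ℕ} (P : Set (EuclideanSpace ℝ (Fin (ℓ 0)) ×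
      EuclideanSpace ℝ (Fin (ℓ (k + 1)))))
    {H : EuclideanSpace ℝ (Fin (ℓ (k + 1))) × Param ℓ (k + 1) ×
      EuclideanSpace ℝ (Fin (ℓ (k + 1))) → ℝ} (hH : ContDiff ℝ 1 H) {a b : ι → ℝ → ℝ}
    (hgrow : ∀ r : ℝ, 0 < r → ∀ (U : EuclideanSpace ℝ (Fin (ℓ (k + 1)))) (Θ : Param ℓ (k + 1)),
      (∀ i, |U i| ≤ r) → (∀ i, |Θ i| ≤ r) → ∃ C : ℝ,
        ∀ (x : EuclideanSpace ℝ (Fin (ℓ 0))) (y u : EuclideanSpace ℝ (Fin (ℓ (k + 1))))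
          (θ : Param ℓ (k + 1)),
          (x, y) ∈ P → (∀ i, |x i| ≤ r) → (∀ i, |u i| ≤ r) → (∀ i, |θ i| ≤ r) →
          (‖∇ (fun u' => H (u', θ, y)) u‖ + ‖∇ (fun θ' => H (u, θ', y)) θ‖)
            / (1 + |H (U, Θ, y)|) ≤ C)
    (h : ∀ R : ℝ, ∃ C, ∀ n x, |x| ≤ R → |a n x| ≤ C ∧ |b n x| ≤ C) (R : ℝ) :
    ∃ C, ∀ n (θ : Param ℓ (k + 1)), ∀ p ∈ P, ‖θ‖ ≤ R → ‖p.1‖ ≤ R →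
      ‖lossDeriv H (a n) (b n) θ p‖ ≤ C * (1 + |H (0, 0, p.2)|) := by
  obtain ⟨K, hK⟩ := exists_layers_bound (ℓ := ℓ) (L := k + 1) h R k
  -- This radius covers inputs and parameters (by `R`) as well as network outputs (by `K`); the
  -- reference point `U = Θ = 0` makes the bound depend on the data only through `y`.
  have hr : 0 < max 1 (max R K) := lt_max_of_lt_left one_pos
  obtain ⟨C, hC⟩ := hgrow _ hr 0 0 (by simp) (by simp)
  refine ⟨(1 + ℓ (k + 1) * |K|) * |C|, fun n θ p hp hθ hx => ?_⟩
  have hk := hK n θ p.1 hθ hx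
  have h1 := hC p.1 p.2 (realization (a n) θ p.1 (k + 1)) θ hp
    (fun i => (PiLp.norm_apply_le p.1 i).trans (hx.trans (by simp)))
    (fun i => (hk i).1.trans (by simp))
    (fun i => (PiLp.norm_apply_le θ i).trans (hθ.trans (by simp)))
  rw [div_le_iff₀ (by positivity)] at h1
  refine (norm_fderiv_comp_le hH _ _ _ _).trans ?_
  rw [mul_assoc]
  refine mul_le_mul ?_ (h1.trans ?_) (by positivity) (by positivity)
  · gcongr
    exact norm_realizationDeriv_le fun i => (hk i).2.trans (le_abs_self K)
  · gcongr
    exact le_abs_self C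

/-! ### Approximated activations and differentiation of the risk. -/

/-- `a n`, `n ≥ 1`, are `C¹` functions with derivatives `b n` which are locally uniformly bounded and
agree eventually, at every point, with the function `a 0` and its generalized derivative `b 0`. -/
structure IsActivationApprox (a b : ℕ → ℝ → ℝ) : Prop where
  hasDerivAt : ∀ n ≠ 0, ∀ x, HasDerivAt (a n) (b n x) x
  continuous_deriv : ∀ n ≠ 0, Continuous (b n)
  eventually_eq : ∀ x, ∀ᶠ n in atTop, a n x = a 0 x ∧ b n x = b 0 x
  bounded : ∀ R : ℝ, ∃ C, ∀ n x, |x| ≤ R → |a n x| ≤ C ∧ |b n x| ≤ C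

namespace IsActivationApprox

variable {a b : ℕ → ℝ → ℝ}

/-- The mean value inequality handles `n ≠ 0`. For `n = 0`, some `a m` agrees with `a 0` at both
points, and the constant does not depend on `m`. -/
theorem exists_lipschitz (h : IsActivationApprox a b) (R : ℝ) :
    ∃ C, 0 ≤ C ∧ ∀ n x y, |x| ≤ R → |y| ≤ R → |a n x - a n y| ≤ C * |x - y| := by
  obtain ⟨C, hC⟩ := h.bounded R
  have pos : ∀ n ≠ 0, ∀ x y, |x| ≤ R → |y| ≤ R → |a n x - a n y| ≤ C * |x - y| := by
    intro n hn x y hx hy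
    exact (convex_Icc (-R) R).norm_image_sub_le_of_norm_hasDerivWithin_le
      (fun z _ => (h.hasDerivAt n hn z).hasDerivWithinAt)
      (fun z hz => (hC n z (abs_le.2 hz)).2) (abs_le.1 hy) (abs_le.1 hx)
  refine ⟨|C|, abs_nonneg C, fun n x y hx hy => ?_⟩
  suffices |a n x - a n y| ≤ C * |x - y| from
    this.trans (mul_le_mul_of_nonneg_right (le_abs_self C) (abs_nonneg _))
  rcases eq_or_ne n 0 with rfl | hn
  · obtain ⟨m, ⟨h1, h2⟩, hm⟩ := ((h.eventually_eq x).and (h.eventually_eq y)).and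
      (eventually_ne_atTop 0) |>.exists
    rw [← h1.1, ← h2.1]
    exact pos m hm x y hx hy
  · exact pos n hn x y hx hy

theorem continuous (h : IsActivationApprox a b) (n : ℕ) : Continuous (a n) := by
  rw [continuous_iff_continuousAt]
  intro x
  obtain ⟨C, -, hC⟩ := h.exists_lipschitz (|x| + 1)
  refine continuousAt_of_locally_lipschitz one_pos C fun y hy => ?_
  rw [Real.dist_eq] at hy ⊢
  rw [Real.dist_eq]
  refine hC n y x ?_ (by linarith)
  have := abs_sub_abs_le_abs_sub y x
  linarith

theorem continuous_realization (h : IsActivationApprox a b) (n k : ℕ) (i : Fin (ℓ (k + 1))) :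
    Continuous fun q : Param ℓ L × EuclideanSpace ℝ (Fin (ℓ 0)) =>
      realization (a n) q.1 q.2 (k + 1) i := by
  rw [continuous_iff_continuousAt]
  intro q
  -- Only the values are needed here, so the formal derivative is taken to be `0`.
  exact (tendsto_layers (θ := Prod.fst) (x := Prod.snd) (a := fun _ => a n) (b := fun _ _ => 0)
    (b₀ := fun _ => 0)
    continuousAt_fst continuousAt_snd fun m _ i hi =>
      ⟨((h.continuous n).tendsto _).comp hi, tendsto_const_nhds⟩) i |>.1

variable {k : ℕ}
  {μ : Measure (EuclideanSpace ℝ (Fin (ℓ 0)) × EuclideanSpace ℝ (Fin (ℓ (k + 1))))}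
  {H : EuclideanSpace ℝ (Fin (ℓ (k + 1))) × Param ℓ (k + 1) ×
    EuclideanSpace ℝ (Fin (ℓ (k + 1))) → ℝ}

/-- For `n = 0` the formal derivative may be discontinuous, but it is a pointwise limit of
continuous ones. -/
theorem aestronglyMeasurable_lossDeriv (h : IsActivationApprox a b) (hH : ContDiff ℝ 1 H) (n : ℕ)
    (θ : Param ℓ (k + 1)) :
    AEStronglyMeasurable (lossDeriv H (a n) (b n) θ) μ := by
  have pos : ∀ n ≠ 0, Continuous (lossDeriv H (a n) (b n) θ) := by
    intro n hn
    rw [continuous_iff_continuousAt]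
    intro p
    exact tendsto_lossDeriv hH tendsto_const_nhds tendsto_id (h.continuous n)
      fun m _ i hi => ((h.continuous_deriv n hn).tendsto _).comp hi
  rcases eq_or_ne n 0 with rfl | hn
  · refine aestronglyMeasurable_of_tendsto_ae atTop
      (f := fun m => lossDeriv H (a (m + 1)) (b (m + 1)) θ)
      (fun m => (pos (m + 1) m.succ_ne_zero).aestronglyMeasurable)
      (Eventually.of_forall fun p => ?_)
    exact tendsto_nhds_of_eventually_eq ((tendsto_add_atTop_nat 1).eventually
      ((eventually_loss_eq H h.eventually_eq θ p).mono fun n hn => hn.2))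
  · exact (pos n hn).aestronglyMeasurable

theorem loss_lipschitz (h : IsActivationApprox a b) (hH : ContDiff ℝ 1 H)
    {p : EuclideanSpace ℝ (Fin (ℓ 0)) × EuclideanSpace ℝ (Fin (ℓ (k + 1)))} {R C : ℝ}
    (hC : ∀ n (θ : Param ℓ (k + 1)), ‖θ‖ ≤ R → ‖lossDeriv H (a n) (b n) θ p‖ ≤ C) (n : ℕ)
    {θ θ' : Param ℓ (k + 1)} (hθ : ‖θ‖ ≤ R) (hθ' : ‖θ'‖ ≤ R) :
    ‖H (realization (a n) θ p.1 (k + 1), θ, p.2) -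
      H (realization (a n) θ' p.1 (k + 1), θ', p.2)‖ ≤ C * ‖θ - θ'‖ := by
  have pos : ∀ n ≠ 0, ‖H (realization (a n) θ p.1 (k + 1), θ, p.2) -
      H (realization (a n) θ' p.1 (k + 1), θ', p.2)‖ ≤ C * ‖θ - θ'‖ := by
    intro n hn
    exact (convex_closedBall (0 : Param ℓ (k + 1)) R).norm_image_sub_le_of_norm_hasFDerivWithin_le
      (f := fun θ => H (realization (a n) θ p.1 (k + 1), θ, p.2))
      (fun θ _ => (hasFDerivAt_loss hH fun m _ i => h.hasDerivAt n hn _).hasFDerivWithinAt)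
      (fun θ hθ => hC n θ (by simpa using hθ)) (by simpa using hθ') (by simpa using hθ)
  rcases eq_or_ne n 0 with rfl | hn
  · obtain ⟨m, ⟨h1, h2⟩, hm⟩ := ((eventually_loss_eq H h.eventually_eq θ p).and
      (eventually_loss_eq H h.eventually_eq θ' p)).and (eventually_ne_atTop 0) |>.exists
    rw [← h1.1, ← h2.1]
    exact pos m hm
  · exact pos n hn

/-- Differentiation under the integral sign. -/
theorem hasFDerivAt_risk (h : IsActivationApprox a b) (hH : ContDiff ℝ 1 H)
    (hint : ∀ n (θ : Param ℓ (k + 1)),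
      Integrable (fun p => H (realization (a n) θ p.1 (k + 1), θ, p.2)) μ)
    {bound : EuclideanSpace ℝ (Fin (ℓ 0)) × EuclideanSpace ℝ (Fin (ℓ (k + 1))) → ℝ}
    (hbound : Integrable bound μ) {R : ℝ}
    (hdom : ∀ᵐ p ∂μ, ∀ n (θ : Param ℓ (k + 1)), ‖θ‖ ≤ R →
      ‖lossDeriv H (a n) (b n) θ p‖ ≤ bound p) (n : ℕ) {θ : Param ℓ (k + 1)} (hθ : ‖θ‖ < R)
    (hdiff : ∀ᵐ p ∂μ, ∀ m < k, ∀ i, HasDerivAt (a n) (b n (realization (a n) θ p.1 (m + 1) i))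
      (realization (a n) θ p.1 (m + 1) i)) :
    HasFDerivAt (risk μ H (a n)) (∫ p, lossDeriv H (a n) (b n) θ p ∂μ) θ := by
  -- The Lipschitz version asks for differentiability of the integrand at `θ` alone. This matters
  -- for `n = 0`, where nearby parameters may send inputs to kinks.
  refine (hasFDerivAt_integral_of_dominated_loc_of_lip' (s := Metric.ball 0 R) (bound := bound)
    (Metric.isOpen_ball.mem_nhds (by simpa using hθ))
    (fun θ' _ => (hint n θ').aestronglyMeasurable) (hint n θ)
    (h.aestronglyMeasurable_lossDeriv hH n θ) ?_ hbound ?_).2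
  · filter_upwards [hdom] with p hp θ' hθ'
    exact h.loss_lipschitz hH hp n (by simpa using (mem_ball_zero_iff.1 hθ').le) hθ.le
  · filter_upwards [hdiff] with p hp
    exact hasFDerivAt_loss hH hp

theorem tendsto_integral_lossDeriv (h : IsActivationApprox a b) (hH : ContDiff ℝ 1 H)
    {bound : EuclideanSpace ℝ (Fin (ℓ 0)) × EuclideanSpace ℝ (Fin (ℓ (k + 1))) → ℝ}
    (hbound : Integrable bound μ) {θ : Param ℓ (k + 1)}
    (hdom : ∀ᵐ p ∂μ, ∀ n, ‖lossDeriv H (a n) (b n) θ p‖ ≤ bound p) :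
    Tendsto (fun n => ∫ p, lossDeriv H (a n) (b n) θ p ∂μ) atTop
      (𝓝 (∫ p, lossDeriv H (a 0) (b 0) θ p ∂μ)) := by
  refine tendsto_integral_of_dominated_convergence bound
    (fun n => h.aestronglyMeasurable_lossDeriv hH n θ) hbound
    (fun n => hdom.mono fun p hp => hp n) (Eventually.of_forall fun p => ?_)
  exact tendsto_nhds_of_eventually_eq
    ((eventually_loss_eq H h.eventually_eq θ p).mono fun n hn => hn.2)

end IsActivationApprox

/-! ### A direction that moves all preactivations to one side. -/

/-- The parameter vector with vanishing weights all of whose biases in layer `k + 1` are `c k`. -/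
def biasVector (ℓ : ℕ → ℕ) (L : ℕ) (c : ℕ → ℝ) : Param ℓ L :=
  WithLp.toLp 2 fun m => ∑ k ∈ Finset.range L,
    if numParams ℓ k + ℓ (k + 1) * ℓ k ≤ m ∧ (m : ℕ) < numParams ℓ (k + 1) then c k else 0

theorem biasVector_apply (c : ℕ → ℝ) (m : Fin (numParams ℓ L)) :
    biasVector ℓ L c m = ∑ k ∈ Finset.range L,
      if numParams ℓ k + ℓ (k + 1) * ℓ k ≤ m ∧ (m : ℕ) < numParams ℓ (k + 1) then c k else 0 := rfl

theorem weight_biasVector (c : ℕ → ℝ) {k : ℕ} (hk : k < L) (i : Fin (ℓ (k + 1))) (j : Fin (ℓ k)) :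
    weight (biasVector ℓ L c) k i j = 0 := by
  have hi : ((i : ℕ) + 1) * ℓ k ≤ ℓ (k + 1) * ℓ k := Nat.mul_le_mul_right _ i.isLt
  have hj := j.isLt
  rw [weight, coord, dif_pos (weight_index_lt hk i j), biasVector_apply]
  refine Finset.sum_eq_zero fun m _ => if_neg ?_
  rintro ⟨h1, h2⟩
  dsimp only at h1 h2
  -- Each layer's block lists its weights before its biases: a weight of block `k` lies after block
  -- `m` if `m < k`, before the biases if `m = k`, and before block `m` if `m > k`.
  rcases lt_trichotomy m k with h | rfl | h
  · have := numParams_mono ℓ (Nat.succ_le_of_lt h)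
    simp only [Nat.succ_eq_add_one] at this
    omega
  · nlinarith
  · have := numParams_mono ℓ (Nat.succ_le_of_lt h)
    rw [Nat.succ_eq_add_one, numParams_succ] at this
    nlinarith

theorem bias_biasVector (c : ℕ → ℝ) {k : ℕ} (hk : k < L) (i : Fin (ℓ (k + 1))) :
    bias (biasVector ℓ L c) k i = c k := by
  have hi := i.isLt
  rw [bias, coord, dif_pos (bias_index_lt hk i), biasVector_apply]
  have hs := numParams_succ ℓ k
  refine (Finset.sum_eq_single k (fun m _ hm => if_neg ?_) 
    (fun h => (h (Finset.mem_range.2 hk)).elim)).trans (if_pos ?_)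
  · rintro ⟨h1, h2⟩
    dsimp only at h1 h2
    rcases hm.lt_or_gt with h | h
    · have := numParams_mono ℓ (Nat.succ_le_of_lt h)
      simp only [Nat.succ_eq_add_one] at this
      omega
    · have := numParams_mono ℓ (Nat.succ_le_of_lt h)
      rw [Nat.succ_eq_add_one] at this
      rw [mul_add] at hs
      omega
  · rw [mul_add] at hs
    dsimp only
    constructor <;> omega

theorem weight_add_smul_biasVector (θ : Param ℓ L) (c : ℕ → ℝ) (t : ℝ) {k : ℕ} (hk : k < L)
    (i : Fin (ℓ (k + 1))) (j : Fin (ℓ k)) :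
    weight (θ + t • biasVector ℓ L c) k i j = weight θ k i j := by
  rw [← weightL_apply, map_add, map_smul, weightL_apply, weightL_apply, weight_biasVector c hk]
  simp

theorem bias_add_smul_biasVector (θ : Param ℓ L) (c : ℕ → ℝ) (t : ℝ) {k : ℕ} (hk : k < L)
    (i : Fin (ℓ (k + 1))) :
    bias (θ + t • biasVector ℓ L c) k i = bias θ k i + t * c k := by
  rw [← biasL_apply, map_add, map_smul, biasL_apply, biasL_apply, bias_biasVector c hk, smul_eq_mul]

/-- There is a direction in which, for all inputs in a ball, all preactivations increase strictly
(if `z = 1`) or decrease strictly (if `z = -1`). -/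
theorem IsActivationApprox.exists_direction {a b : ℕ → ℝ → ℝ} (h : IsActivationApprox a b)
    (θ : Param ℓ L) (R : ℝ) {z : ℝ} (hz : |z| = 1) :
    ∃ v : Param ℓ L, ∃ δ > 0, δ * ‖v‖ ≤ 1 ∧
      ∀ x : EuclideanSpace ℝ (Fin (ℓ 0)), ‖x‖ ≤ R → ∀ k < L, ∀ i, ∀ s t : ℝ, 0 ≤ s → s < t → t ≤ δ →
        z * realization (a 0) (θ + s • v) x (k + 1) i <
          z * realization (a 0) (θ + t • v) x (k + 1) i := by
  have hK : ∃ K, ∀ k < L, ∀ (θ' : Param ℓ L) (x : EuclideanSpace ℝ (Fin (ℓ 0))),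
      ‖θ'‖ ≤ ‖θ‖ + 1 → ‖x‖ ≤ R → ∀ i, |realization (a 0) θ' x (k + 1) i| ≤ K := by
    choose K hK using exists_layers_bound (ℓ := ℓ) (L := L) h.bounded (max (‖θ‖ + 1) R)
    refine ⟨∑ k ∈ Finset.range L, |K k|, fun k hk θ' x hθ hx i => ?_⟩
    refine ((hK k 0 θ' x (le_max_of_le_left hθ) (le_max_of_le_right hx) i).1.trans
      (le_abs_self _)).trans ?_
    exact Finset.single_le_sum (f := fun k => |K k|) (fun _ _ => abs_nonneg _)
      (Finset.mem_range.2 hk)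
  obtain ⟨K, hK⟩ := hK
  obtain ⟨C, hC0, hC⟩ := h.exists_lipschitz K
  set P : ℝ := ∑ k ∈ Finset.range L, (ℓ k : ℝ) with hP
  have hP0 : 0 ≤ P := Finset.sum_nonneg fun _ _ => Nat.cast_nonneg _
  -- The biases of layer `k + 1` move at speed `M ^ k`; this `M` lets them outweigh the change
  -- inherited from earlier layers, which is at most about `2 * P * ‖θ‖ * C` times the previous
  -- speed.
  set M : ℝ := 4 * (P * ‖θ‖ * C) + 1 with hM
  have hMpos : 0 < M := by positivity
  set v := biasVector ℓ L fun k => z * M ^ k with hv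
  have hδ : 0 < (1 + ‖v‖)⁻¹ := by positivity
  have hδv : (1 + ‖v‖)⁻¹ * ‖v‖ ≤ 1 := by
    rw [inv_mul_le_iff₀ (by positivity)]; linarith
  refine ⟨v, _, hδ, hδv, fun x hx k hk i s t hs hst ht => ?_⟩
  have hball : ∀ r, 0 ≤ r → r ≤ (1 + ‖v‖)⁻¹ → ‖θ + r • v‖ ≤ ‖θ‖ + 1 := by
    intro r hr hr'
    refine (norm_add_le _ _).trans (add_le_add le_rfl ?_)
    rw [norm_smul, Real.norm_of_nonneg hr]
    exact (mul_le_mul_of_nonneg_right hr' (norm_nonneg _)).trans hδv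
  have hzz : z * z = 1 := by rw [← abs_mul_abs_self, hz, one_mul]
  -- Every increment equals its bias increment up to a relative error of one half, which fixes its
  -- sign and bounds its size for the next layer.
  have key : ∀ k < L, ∀ i, |realization (a 0) (θ + t • v) x (k + 1) i -
      realization (a 0) (θ + s • v) x (k + 1) i - z * (M ^ k * (t - s))| ≤ M ^ k * (t - s) / 2 := by
    intro k
    induction k with
    | zero =>
      intro hk i
      rw [realization_succ, realization_succ, bias_add_smul_biasVector _ _ _ hk,
        bias_add_smul_biasVector _ _ _ hk]
      simp_rw [hv, weight_add_smul_biasVector _ _ _ hk, layerOut]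
      rw [show ∀ p q : ℝ, p + t * (z * M ^ 0) + q - (p + s * (z * M ^ 0) + q) -
        z * (M ^ 0 * (t - s)) = 0 by intro p q; ring, abs_zero]
      have : 0 ≤ t - s := by linarith
      positivity
    | succ k ih =>
      intro hk i
      have hk' : k < L := k.lt_succ_self.trans hk
      have hts : 0 ≤ M ^ k * (t - s) := mul_nonneg (by positivity) (by linarith)
      rw [realization_succ, realization_succ, bias_add_smul_biasVector _ _ _ hk,
        bias_add_smul_biasVector _ _ _ hk]
      simp_rw [hv, weight_add_smul_biasVector _ _ _ hk, ← hv]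
      rw [show ∀ p q q' : ℝ, p + t * (z * M ^ (k + 1)) + q - (p + s * (z * M ^ (k + 1)) + q') -
        z * (M ^ (k + 1) * (t - s)) = q - q' by intro p q q'; ring, ← Finset.sum_sub_distrib]
      have hterm : ∀ j, |weight θ (k + 1) i j * layerOut (a 0) (θ + t • v) x (k + 1) j -
          weight θ (k + 1) i j * layerOut (a 0) (θ + s • v) x (k + 1) j| ≤
          ‖θ‖ * (C * (2 * (M ^ k * (t - s)))) := by
        intro j
        rw [← mul_sub, abs_mul]
        refine mul_le_mul (abs_coord_le _ _) ?_ (abs_nonneg _) (norm_nonneg _)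
        rw [layerOut_succ, layerOut_succ]
        refine (hC 0 _ _ (hK k hk' _ x (hball t (hs.trans hst.le) ht) hx j)
          (hK k hk' _ x (hball s hs (hst.le.trans ht)) hx j)).trans ?_
        refine mul_le_mul_of_nonneg_left ?_ hC0
        have h1 := ih hk' j
        have h2 : |z * (M ^ k * (t - s))| = M ^ k * (t - s) := by
          rw [abs_mul, hz, one_mul, abs_of_nonneg hts]
        have h3 := abs_sub_abs_le_abs_sub (realization (a 0) (θ + t • v) x (k + 1) j -
          realization (a 0) (θ + s • v) x (k + 1) j) (z * (M ^ k * (t - s)))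
        linarith
      refine (Finset.abs_sum_le_sum_abs _ _).trans
        ((Finset.sum_le_sum fun j _ => hterm j).trans ?_)
      rw [Finset.sum_const, Finset.card_univ, Fintype.card_fin, nsmul_eq_mul]
      have hPk : (ℓ (k + 1) : ℝ) ≤ P := Finset.single_le_sum (f := fun k => (ℓ k : ℝ))
        (fun _ _ => Nat.cast_nonneg _) (Finset.mem_range.2 hk)
      have h4 : (ℓ (k + 1) : ℝ) * (‖θ‖ * (C * (2 * (M ^ k * (t - s))))) ≤
          P * (‖θ‖ * (C * (2 * (M ^ k * (t - s))))) :=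
        mul_le_mul_of_nonneg_right hPk (by positivity)
      have h5 : M ^ (k + 1) * (t - s) / 2 =
          P * (‖θ‖ * (C * (2 * (M ^ k * (t - s))))) + M ^ k * (t - s) / 2 := by
        rw [pow_succ, hM]; ring
      linarith
  have hpos : 0 < M ^ k * (t - s) := mul_pos (by positivity) (by linarith)
  have h1 := key k hk i
  have h2 : |z * (realization (a 0) (θ + t • v) x (k + 1) i -
      realization (a 0) (θ + s • v) x (k + 1) i - z * (M ^ k * (t - s)))| ≤
      M ^ k * (t - s) / 2 := by rwa [abs_mul, hz, one_mul]
  rw [mul_sub, ← mul_assoc, hzz, one_mul] at h2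
  have := (abs_le.1 h2).1
  linarith

/-! ### Subgradients and one-sided continuity. -/

theorem mem_frechetSubdiff_of_hasFDerivAt {n : ℕ} {f : EuclideanSpace ℝ (Fin n) → ℝ}
    {x : EuclideanSpace ℝ (Fin n)} {f' : EuclideanSpace ℝ (Fin n) →L[ℝ] ℝ}
    (h : HasFDerivAt f f' x) : (InnerProductSpace.toDual ℝ _).symm f' ∈ frechetSubdiff f x := by
  have h1 : Tendsto (fun h : EuclideanSpace ℝ (Fin n) => (f (x + h) - f x - f' h) / ‖h‖)
      (𝓝[≠] 0) (𝓝 0) := by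
    have := (hasFDerivAt_iff_isLittleO_nhds_zero.1 h).norm_right.tendsto_div_nhds_zero
    exact this.mono_left nhdsWithin_le_nhds
  have h2 := (continuous_coe_real_ereal.tendsto 0).comp h1
  change (0 : EReal) ≤ liminf _ _
  -- In dimension zero the punctured neighbourhood filter is trivial and the liminf is `⊤`.
  rcases (𝓝[≠] (0 : EuclideanSpace ℝ (Fin n))).eq_or_neBot with hb | hb
  · rw [hb, liminf_bot]; exact le_top
  · simp_rw [InnerProductSpace.toDual_symm_apply]
    exact h2.liminf_eq.ge

theorem mem_limitingSubdiff_of_frequently {ι : Type*} {l : Filter ι} {n : ℕ}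
    {f : EuclideanSpace ℝ (Fin n) → ℝ} {x : ι → EuclideanSpace ℝ (Fin n)}
    {x₀ : EuclideanSpace ℝ (Fin n)} {w : ι → EuclideanSpace ℝ (Fin n)}
    {w₀ : EuclideanSpace ℝ (Fin n)} (hx : Tendsto x l (𝓝 x₀)) (hw : Tendsto w l (𝓝 w₀))
    (h : ∃ᶠ t in l, w t ∈ frechetSubdiff f (x t)) : w₀ ∈ limitingSubdiff f x₀ := by
  refine Set.mem_iInter₂.2 fun ε hε => mem_closure_of_frequently_of_tendsto ?_ hw
  refine (h.and_eventually (hx (Metric.ball_mem_nhds x₀ hε))).mono fun t ht => ?_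
  exact Set.mem_biUnion ht.2 ht.1

theorem hasDerivAt_genDeriv {S : Finset ℝ} (gS : ↥(S : Set ℝ) → ℝ) {f : ℝ → ℝ}
    (hf : ContDiffOn ℝ 1 f (S : Set ℝ)ᶜ) {x : ℝ} (hx : x ∉ S) :
    HasDerivAt f (genDeriv S gS f x) x := by
  have : genDeriv S gS f x = deriv f x := dif_neg (by simpa using hx)
  rw [this]
  exact ((hf.contDiffAt (S.isClosed.isOpen_compl.mem_nhds (by simpa using hx))).differentiableAt
    one_ne_zero).hasDerivAt

theorem continuousAt_genDeriv {S : Finset ℝ} (gS : ↥(S : Set ℝ) → ℝ) {f : ℝ → ℝ}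
    (hf : ContDiffOn ℝ 1 f (S : Set ℝ)ᶜ) {x : ℝ} (hx : x ∉ S) :
    ContinuousAt (genDeriv S gS f) x := by
  have hopen := S.isClosed.isOpen_compl
  have hmem : (S : Set ℝ)ᶜ ∈ 𝓝 x := hopen.mem_nhds (by simpa using hx)
  refine ((hf.continuousOn_deriv_of_isOpen hopen le_rfl).continuousAt hmem).congr ?_
  filter_upwards [hmem] with y hy
  have : genDeriv S gS f y = deriv f y := dif_neg hy
  exact this.symm

theorem tendsto_of_oneSidedJump_eq_zero {S : Finset ℝ} {f : ℝ → ℝ} {z : ℝ}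
    (h : oneSidedJump S f z = 0) {s : ℝ} (hs : s ∈ S) :
    Tendsto (fun t => f (s + z * t)) (𝓝[>] 0) (𝓝 (f s)) := by
  have h1 := (Finset.sum_eq_zero_iff.1 h) s hs
  rw [Metric.tendsto_nhds]
  intro ε hε
  have h2 := eventually_lt_of_limsup_lt (h1.trans_lt (ENNReal.ofReal_pos.2 hε))
  filter_upwards [h2] with t ht
  rw [Real.dist_eq]
  exact (ENNReal.ofReal_lt_ofReal_iff hε).1 ht

/-- Since `z * z = 1`, one has `N t = s + z * (z * (N t - s))`, and the inner factor tends to `0`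
from above. -/
theorem tendsto_comp_of_oneSided {ι : Type*} {l : Filter ι} {f : ℝ → ℝ} {z s : ℝ} (hz : z * z = 1)
    (hf : Tendsto (fun t => f (s + z * t)) (𝓝[>] 0) (𝓝 (f s))) {N : ι → ℝ}
    (hN : Tendsto N l (𝓝 s)) (hlt : ∀ᶠ t in l, z * s < z * N t) :
    Tendsto (fun t => f (N t)) l (𝓝 (f s)) := by
  have h1 : Tendsto (fun t => z * (N t - s)) l (𝓝[>] 0) := by
    refine tendsto_nhdsWithin_iff.2 ⟨?_, ?_⟩
    · simpa using (hN.sub_const s).const_mul z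
    · filter_upwards [hlt] with t ht
      rw [Set.mem_Ioi]; linarith
  refine (hf.comp h1).congr fun t => ?_
  simp only [Function.comp_apply, ← mul_assoc, hz]
  ring_nf

/-- Turns the integrability assumption at the zero parameter into integrability of `H (0, 0, y)`. -/
theorem realization_zero_param (a : ℝ → ℝ) (x : EuclideanSpace ℝ (Fin (ℓ 0))) (k : ℕ) :
    realization a (0 : Param ℓ L) x (k + 1) = 0 := by
  ext i
  rw [realization_succ]
  simp [bias, weight, ← coordL_apply]

theorem isActivationApprox {S : Finset ℝ} {gS : ↥(S : Set ℝ) → ℝ} {g : ℕ → ℝ → ℝ}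
    (hg : ∀ n, 1 ≤ n → ContDiff ℝ 1 (g n))
    (hconv : ∀ x : ℝ, ∃ m : ℕ, 1 ≤ m ∧
      ∑' n : ℕ, ENNReal.ofReal (|g (m + n) x - g 0 x|
        + |deriv (g (m + n)) x - genDeriv S gS (g 0) x|) = 0)
    (hloc : ∀ m : ℕ, ∃ C : ℝ, ∀ n, 1 ≤ n → ∀ x ∈ Set.Icc (-(m : ℝ)) m,
      |g n x| + |deriv (g n) x| ≤ C) :
    IsActivationApprox g fun n => if n = 0 then genDeriv S gS (g 0) else deriv (g n) := by
  have hev : ∀ x, ∀ᶠ n in atTop, n ≠ 0 ∧ g n x = g 0 x ∧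
      deriv (g n) x = genDeriv S gS (g 0) x := by
    intro x
    obtain ⟨m, hm, hsum⟩ := hconv x
    filter_upwards [eventually_ge_atTop m] with n hn
    -- A vanishing series in `[0, ∞]` has only zero terms.
    have h1 := ENNReal.ofReal_eq_zero.1 (ENNReal.tsum_eq_zero.1 hsum (n - m))
    rw [Nat.add_sub_cancel' hn] at h1
    have h2 := abs_nonneg (g n x - g 0 x)
    have h3 := abs_nonneg (deriv (g n) x - genDeriv S gS (g 0) x)
    exact ⟨by omega, sub_eq_zero.1 (abs_eq_zero.1 (by linarith)),
      sub_eq_zero.1 (abs_eq_zero.1 (by linarith))⟩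
  refine ⟨fun n hn x => ?_, fun n hn => ?_, fun x => ?_, fun R => ?_⟩
  · simp only [if_neg hn]
    exact (((hg n (Nat.one_le_iff_ne_zero.2 hn)).differentiable one_ne_zero) x).hasDerivAt
  · simp only [if_neg hn]
    exact (hg n (Nat.one_le_iff_ne_zero.2 hn)).continuous_deriv le_rfl
  · filter_upwards [hev x] with n hn
    simpa [hn.1] using hn.2
  · obtain ⟨C, hC⟩ := hloc ⌈R⌉₊
    have pos : ∀ n ≠ 0, ∀ x, |x| ≤ R → |g n x| ≤ C ∧ |deriv (g n) x| ≤ C := by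
      intro n hn x hx
      have h1 := hC n (Nat.one_le_iff_ne_zero.2 hn) x (abs_le.1 (hx.trans (Nat.le_ceil R)))
      constructor <;> linarith [abs_nonneg (g n x), abs_nonneg (deriv (g n) x)]
    refine ⟨C, fun n x hx => ?_⟩
    rcases eq_or_ne n 0 with rfl | hn
    · obtain ⟨m, hm, h1, h2⟩ := (hev x).exists
      simpa [h1, h2] using pos m hm x hx
    · simpa [hn] using pos n hn x hx

/-! ### Kinks are avoided at all but countably many times. -/

/-- If preactivations move strictly monotonically along a curve of parameters, then for frequently
many parameters on the curve almost no input is mapped to a kink. -/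
theorem frequently_ae_notMem {X : Type*} [MeasurableSpace X] {μ : Measure X} [IsFiniteMeasure μ]
    {ι : Type*} [Countable ι] {S : Finset ℝ} {δ : ℝ} (hδ : 0 < δ) {N : ι → ℝ → X → ℝ}
    (hN : ∀ i t, Measurable (N i t)) {B : Set X} (hB : B ∈ ae μ) {z : ℝ}
    (hmono : ∀ x ∈ B, ∀ i, ∀ s t : ℝ, 0 < s → s < t → t ≤ δ → z * N i s x < z * N i t x) :
    ∃ᶠ t in 𝓝[>] 0, ∀ᵐ x ∂μ, ∀ i, N i t x ∉ S := by
  have hcount : ∀ (i : ι) (s : ℝ),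
      {t : Set.Ioc 0 δ | 0 < μ (N i t ⁻¹' {s})}.Countable := by
    intro i s
    refine Measure.countable_meas_pos_of_disjoint_iUnion₀
      (fun t => (hN i t (measurableSet_singleton s)).nullMeasurableSet) fun t t' htt' => ?_
    -- On `B` strict monotonicity forbids the same value at two times, so the level sets meet only
    -- outside `B`.
    refine measure_mono_null (t := Bᶜ) ?_ hB
    intro x hx hxB
    have hx' : N i t x = N i t' x := hx.1.trans hx.2.symm
    rcases lt_or_gt_of_ne htt' with h | h
    · exact (hmono x hxB i t t' t.2.1 h t'.2.2).ne (by rw [hx'])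
    · exact (hmono x hxB i t' t t'.2.1 h t.2.2).ne (by rw [hx'])
  have hbad : (⋃ i, ⋃ s ∈ S, Subtype.val ''
      {t : Set.Ioc 0 δ | 0 < μ (N i t ⁻¹' {s})}).Countable :=
    Set.countable_iUnion fun i => S.countable_toSet.biUnion fun s _ => (hcount i s).image _
  rw [frequently_iff]
  intro U hU
  obtain ⟨ε, hε, hεU⟩ := mem_nhdsGT_iff_exists_Ioo_subset.1 hU
  have hpos : (0 : ℝ) < min ε δ := lt_min hε hδ
  -- A countable set has dense complement, so good times exist in every interval next to `0`.
  obtain ⟨t, ht, htbad⟩ := (hbad.dense_compl ℝ).inter_open_nonempty _ isOpen_Ioo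
    (Set.nonempty_Ioo.2 hpos)
  refine ⟨t, hεU ⟨ht.1, ht.2.trans_le (min_le_left _ _)⟩, ae_all_iff.2 fun i => ?_⟩
  have hzero : ∀ s ∈ S, ∀ᵐ x ∂μ, N i t x ≠ s := by
    intro s hs
    by_contra hcon
    have hne : μ (N i t ⁻¹' {s}) ≠ 0 := fun h0 => hcon (measure_eq_zero_iff_ae_notMem.1 h0)
    exact htbad (Set.mem_iUnion.2 ⟨i, Set.mem_biUnion hs
      ⟨⟨t, ht.1, ht.2.le.trans (min_le_right _ _)⟩, pos_iff_ne_zero.2 hne, rfl⟩⟩)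
  filter_upwards [(ae_ball_iff S.countable_toSet).2 hzero] with x hx hmem
  exact hx _ hmem rfl

end DeepANN

end

/-! ### The main theorem. -/

open DeepANN

theorem mainTheorem3
    (ℓ : ℕ → ℕ) (hℓ : ∀ k, 0 < ℓ k) (L : ℕ) (hL : 0 < L)
    -- the kinks `S`, the values of the generalized derivative on them, the activation function
    -- `g 0` and its approximations `g n`, `n ≥ 1`
    (S : Finset ℝ) (gS : ↥(S : Set ℝ) → ℝ) (g : ℕ → ℝ → ℝ)
    (hg : ∀ n, 1 ≤ n → ContDiff ℝ 1 (g n))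
    (hg0 : ContDiffOn ℝ 1 (g 0) (S : Set ℝ)ᶜ)
    (hconv : ∀ x : ℝ, ∃ m : ℕ, 1 ≤ m ∧
      ∑' n : ℕ, ENNReal.ofReal (|g (m + n) x - g 0 x|
        + |deriv (g (m + n)) x - DeepANN.genDeriv S gS (g 0) x|) = 0)
    (μ : Measure (EuclideanSpace ℝ (Fin (ℓ 0)) × EuclideanSpace ℝ (Fin (ℓ L))))
    [IsFiniteMeasure μ]
    (H : EuclideanSpace ℝ (Fin (ℓ L)) × DeepANN.Param ℓ L × EuclideanSpace ℝ (Fin (ℓ L)) → ℝ)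
    (hH : ContDiff ℝ 1 H)
    (hint : ∀ n (θ : DeepANN.Param ℓ L),
      Integrable (fun p => H (DeepANN.realization (g n) θ p.1 L, θ, p.2)) μ)
    (hbdd : Bornology.IsBounded {x | ∃ y, (x, y) ∈ μ.support})
    (hgrow : ∀ r : ℝ, 0 < r → ∀ (U : EuclideanSpace ℝ (Fin (ℓ L))) (Θ : DeepANN.Param ℓ L),
      (∀ i, |U i| ≤ r) → (∀ i, |Θ i| ≤ r) → ∃ C : ℝ,
        ∀ (x : EuclideanSpace ℝ (Fin (ℓ 0))) (y u : EuclideanSpace ℝ (Fin (ℓ L)))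
          (θ : DeepANN.Param ℓ L),
          (x, y) ∈ μ.support → (∀ i, |x i| ≤ r) → (∀ i, |u i| ≤ r) → (∀ i, |θ i| ≤ r) →
          (‖∇ (fun u' => H (u', θ, y)) u‖ + ‖∇ (fun θ' => H (u, θ', y)) θ‖)
            / (1 + |H (U, Θ, y)|) ≤ C)
    (G : DeepANN.Param ℓ L → DeepANN.Param ℓ L)
    (hG : ∀ θ v, Tendsto (fun n => ∇ (DeepANN.risk μ H (g n)) θ) atTop (𝓝 v) → G θ = v)
    -- local uniform boundedness of the approximations and their derivatives
    (hloc : ∀ m : ℕ, ∃ C : ℝ, ∀ n, 1 ≤ n → ∀ x ∈ Set.Icc (-(m : ℝ)) m,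
      |g n x| + |deriv (g n) x| ≤ C)
    -- one-sided continuity of the generalized derivative at all kinks from a common side
    (hside : min (DeepANN.oneSidedJump S (DeepANN.genDeriv S gS (g 0)) (-1))
      (DeepANN.oneSidedJump S (DeepANN.genDeriv S gS (g 0)) 1) = 0)
    (θ : DeepANN.Param ℓ L) :
    G θ ∈ DeepANN.limitingSubdiff (DeepANN.risk μ H (g 0)) θ := by

  obtain ⟨k, rfl⟩ := Nat.exists_eq_succ_of_ne_zero hL.ne'
  have happ := isActivationApprox hg hconv hloc
  set b : ℕ → ℝ → ℝ := fun n => if n = 0 then genDeriv S gS (g 0) else deriv (g n) with hb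
  have hb0 : b 0 = genDeriv S gS (g 0) := if_pos rfl
  obtain ⟨R₀, hR₀⟩ := hbdd.exists_norm_le
  -- The segment stays within norm `‖θ‖ + 1`; radius `‖θ‖ + 2` leaves an open neighbourhood for
  -- differentiating under the integral.
  obtain ⟨C, hC⟩ := exists_lossDeriv_bound μ.support hH hgrow happ.bounded (max R₀ (‖θ‖ + 2))
  have hsupp : ∀ᵐ p ∂μ, p ∈ μ.support ∧ ‖p.1‖ ≤ R₀ := by
    filter_upwards [Measure.support_mem_ae (μ := μ)] with p hp using ⟨hp, hR₀ _ ⟨p.2, hp⟩⟩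
  have hbound : Integrable (fun p : EuclideanSpace ℝ (Fin (ℓ 0)) ×
      EuclideanSpace ℝ (Fin (ℓ (k + 1))) => C * (1 + |H (0, 0, p.2)|)) μ := by
    have h0 := hint 0 0
    simp_rw [Nat.succ_eq_add_one, realization_zero_param] at h0
    exact ((integrable_const 1).add h0.abs).const_mul C
  have hdom : ∀ᵐ p ∂μ, ∀ n (θ' : Param ℓ (k + 1)), ‖θ'‖ ≤ ‖θ‖ + 2 →
      ‖lossDeriv H (g n) (b n) θ' p‖ ≤ C * (1 + |H (0, 0, p.2)|) := by
    filter_upwards [hsupp] with p hp n θ' hθ'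
    exact hC n θ' p hp.1 (le_max_of_le_right hθ') (le_max_of_le_left hp.2)
  have hGθ : G θ = (InnerProductSpace.toDual ℝ _).symm (∫ p, lossDeriv H (g 0) (b 0) θ p ∂μ) := by
    refine hG θ _ ?_
    have h1 := happ.tendsto_integral_lossDeriv hH hbound (θ := θ)
      (hdom.mono fun p hp n => hp n θ (by linarith))
    refine (((InnerProductSpace.toDual ℝ _).symm.continuous.tendsto _).comp h1).congr' ?_
    filter_upwards [eventually_ne_atTop 0] with n hn
    have h2 := happ.hasFDerivAt_risk hH hint hbound hdom n (θ := θ) (by linarith)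
      (Eventually.of_forall fun p m _ i => happ.hasDerivAt n hn _)
    exact (hasFDerivAt_iff_hasGradientAt.1 h2).gradient.symm
  obtain ⟨z, hz, hjump⟩ : ∃ z : ℝ, |z| = 1 ∧ oneSidedJump S (b 0) z = 0 := by
    rw [hb0]
    rcases min_choice (oneSidedJump S (genDeriv S gS (g 0)) (-1))
      (oneSidedJump S (genDeriv S gS (g 0)) 1) with h | h
    · exact ⟨-1, by simp, h.symm.trans hside⟩
    · exact ⟨1, by simp, h.symm.trans hside⟩
  have hzz : z * z = 1 := by rw [← abs_mul_abs_self, hz, one_mul]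
  obtain ⟨v, δ, hδ, hδv, hmono⟩ := happ.exists_direction θ R₀ hz
  have hnear : ∀ᶠ t : ℝ in 𝓝[>] 0, 0 < t ∧ t ≤ δ ∧ ‖θ + t • v‖ < ‖θ‖ + 2 := by
    filter_upwards [Ioc_mem_nhdsGT hδ] with t ht
    refine ⟨ht.1, ht.2, (norm_add_le _ _).trans_lt ?_⟩
    rw [norm_smul, Real.norm_of_nonneg ht.1.le]
    linarith [mul_le_mul_of_nonneg_right ht.2 (norm_nonneg v)]
  have hcurve : Tendsto (fun t : ℝ => θ + t • v) (𝓝[>] 0) (𝓝 θ) := by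
    have : Continuous fun t : ℝ => θ + t • v := by fun_prop
    simpa using (this.tendsto 0).mono_left nhdsWithin_le_nhds
  -- Only the `k` hidden layers are activated, so output neurons may hit `S`.
  have hfreq : ∃ᶠ t : ℝ in 𝓝[>] 0, ∀ᵐ p ∂μ, ∀ q : Σ m : Fin k, Fin (ℓ (m + 1)),
      realization (g 0) (θ + t • v) p.1 (q.1 + 1) q.2 ∉ S := by
    refine frequently_ae_notMem (ι := Σ m : Fin k, Fin (ℓ (m + 1))) (μ := μ) (z := z) hδ
      (N := fun q t p => realization (g 0) (θ + t • v) p.1 (q.1 + 1) q.2)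
      (B := {p | p ∈ μ.support ∧ ‖p.1‖ ≤ R₀}) (fun q t => ?_) hsupp
      fun p hp q s t hs hst ht =>
        hmono p.1 hp.2 q.1 (q.1.isLt.trans k.lt_succ_self) q.2 s t hs.le hst ht
    have hcont : Continuous fun p : EuclideanSpace ℝ (Fin (ℓ 0)) ×
        EuclideanSpace ℝ (Fin (ℓ (k + 1))) => (θ + t • v, p.1) :=
      continuous_const.prodMk continuous_fst
    exact ((happ.continuous_realization 0 q.1 q.2).comp hcont).measurable
  have hlim : Tendsto (fun t : ℝ => ∫ p, lossDeriv H (g 0) (b 0) (θ + t • v) p ∂μ) (𝓝[>] 0)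
      (𝓝 (∫ p, lossDeriv H (g 0) (b 0) θ p ∂μ)) := by
    refine tendsto_integral_filter_of_dominated_convergence _
      (Eventually.of_forall fun t => happ.aestronglyMeasurable_lossDeriv hH 0 _) ?_ hbound ?_
    · filter_upwards [hnear] with t ht
      exact hdom.mono fun p hp => hp 0 _ ht.2.2.le
    · filter_upwards [hsupp] with p hp
      refine tendsto_lossDeriv hH hcurve tendsto_const_nhds (happ.continuous 0) fun m hm i hi => ?_
      by_cases hS : realization (g 0) θ p.1 (m + 1) i ∈ S
      · refine tendsto_comp_of_oneSided hzz (tendsto_of_oneSidedJump_eq_zero hjump hS) hi ?_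
        filter_upwards [hnear] with t ht
        -- Comparing with `s = 0` shows that the kink is approached strictly from side `z`.
        simpa using hmono p.1 hp.2 m (hm.trans k.lt_succ_self) i 0 t le_rfl ht.1 ht.2.1
      · rw [hb0]
        exact (continuousAt_genDeriv gS hg0 hS).tendsto.comp hi
  rw [hGθ]
  refine mem_limitingSubdiff_of_frequently hcurve
    (((InnerProductSpace.toDual ℝ _).symm.continuous.tendsto _).comp hlim) ?_
  refine (hfreq.and_eventually hnear).mono ?_
  rintro t ⟨hae, ht⟩
  refine mem_frechetSubdiff_of_hasFDerivAt
    (happ.hasFDerivAt_risk hH hint hbound hdom 0 ht.2.2 ?_)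
  filter_upwards [hae] with p hp m hm i
  rw [hb0]
  exact hasDerivAt_genDeriv gS hg0 (hp ⟨⟨m, hm⟩, i⟩)
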